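/- Let $n\ge 2$, let $S^n$ be the unit sphere of $\mathbb R^{n+1}$ with its Riemannian surface measure $d\eta$, let $e_{n+1}$ be the last coordinate unit vector, and let $-1<a<1$. Put $\sigma_{n-1}=2\pi^{n/2}/\Gamma(n/2)$. For $\xi\in S^n$ define the spherical slice transform and the Funk transform by $$(\mathcal F_a f)(\xi)=\int_{\{\eta\in S^n:\ \xi\cdot(\eta-ae_{n+1})=0\}} f(\eta)\,d\eta,\qquad (\mathcal F f)(\xi)=\frac1{\sigma_{n-1}}\int_{\{\eta\in S^n:\ \xi\cdot\eta=0\}} f(\eta)\,d\eta,$$ where the integrals are taken with respect to the $(n-1)$-dimensional surface area measure on the section of the sphere. Write $S^{n-1}=\{\psi\in S^n:\psi_{n+1}=0\}$. Let $\mu,\nu:S^n\to S^n$ be the bijections given, for $\psi,\varphi\in S^{n-1}$ and $u,s\in[-1,1]$, by $$\mu\big(\sqrt{1-u^2}\,\psi+u\,e_{n+1}\big)=\sqrt{1-v^2}\,\psi+v\,e_{n+1},\qquad u=\frac{v+a}{1+av},$$ $$\nu\big(\sqrt{1-s^2}\,\varphi+s\,e_{n+1}\big)=\sqrt{1-t^2}\,\varphi+t\,e_{n+1},\qquad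 t=\frac{s\sqrt{1-a^2}}{\sqrt{1-a^2s^2}},$$ and set $$(\mathcal M_a f)(\eta)=\frac{f(\mu^{-1}(\eta))}{(1+a\eta_{n+1})^{n-1}},\qquad (\mathcal N_a\Phi)(\xi)=\sigma_{n-1}(1-a^2)^{(n-1)/2}\,\Phi(\nu(\xi)).$$ **Theorem.** If $f\in L^1(S^n)$ (real- or complex-valued), then $$\mathcal F_a f=\mathcal N_a\,\mathcal F\,\mathcal M_a f .$$ More precisely: $\mathcal M_a f\in L^1(S^n)$, and for almost every $\xi\in S^n$ the integrals defining $(\mathcal F_a f)(\xi)$ and $(\mathcal F\mathcal M_a f)(\nu(\xi))$ converge absolutely and $(\mathcal F_a f)(\xi)=(\mathcal N_a\mathcal F\mathcal M_a f)(\xi)$. -/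

import Mathlib

open MeasureTheory Set

namespace SphericalSlice

noncomputable section

/-- The unit sphere `S^n` of the Euclidean space `ℝ^{n+1}`. -/
abbrev Sph (n : ℕ) : Type := Metric.sphere (0 : EuclideanSpace ℝ (Fin (n + 1))) 1

/-- The last coordinate unit vector `e_{n+1}`. -/
def pole (n : ℕ) : EuclideanSpace ℝ (Fin (n + 1)) := EuclideanSpace.single (Fin.last n) 1

/-- The last coordinate `η_{n+1}` of a point of the sphere. -/
def height {n : ℕ} (η : Sph n) : ℝ := η.1 (Fin.last n)

/-- The Riemannian (surface) measure on `S^n`: the `n`-dimensional Hausdorff measure, normalized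
so that it agrees with Lebesgue measure on `n`-dimensional Euclidean spaces. -/
def surfaceMeasure (n : ℕ) : Measure (Sph n) := Measure.euclideanHausdorffMeasure n

/-- The `(n-1)`-dimensional surface area measure on an `(n-1)`-dimensional slice `γ` of `S^n`. -/
def sliceMeasure {n : ℕ} (γ : Set (Sph n)) : Measure (Sph n) :=
  (Measure.euclideanHausdorffMeasure (n - 1)).restrict γ

/-- `σ_d = 2 π^{(d+1)/2} / Γ((d+1)/2)`, the total surface area of `S^d`. -/
def sphereArea (d : ℕ) : ℝ :=
  2 * Real.pi ^ (((d : ℝ) + 1) / 2) / Real.Gamma (((d : ℝ) + 1) / 2)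

/-- The great subsphere `S^n ∩ ξ^⊥`. -/
def greatSubsphere {n : ℕ} (ξ : Sph n) : Set (Sph n) := {η | inner ℝ ξ.1 η.1 = 0}

/-- The slice of `S^n` by the hyperplane through `A = a e_{n+1}` orthogonal to `ξ`. -/
def slice {n : ℕ} (a : ℝ) (ξ : Sph n) : Set (Sph n) :=
  {η | inner ℝ ξ.1 (η.1 - a • pole n) = 0}

section Transforms

variable {𝕜 : Type*} [RCLike 𝕜] {n : ℕ}

/-- The Funk transform. -/
def funk (f : Sph n → 𝕜) (ξ : Sph n) : 𝕜 :=
  (sphereArea (n - 1))⁻¹ • ∫ η, f η ∂(sliceMeasure (greatSubsphere ξ))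

/-- The spherical slice transform `F_a`. -/
def sliceTransform (a : ℝ) (f : Sph n → 𝕜) (ξ : Sph n) : 𝕜 :=
  ∫ η, f η ∂(sliceMeasure (slice a ξ))

end Transforms

/-! ### Meridional maps -/

/-- Coordinates on the sphere: the vector `√(1-u²) ψ + u e_{n+1}`, where `ψ` is meant to lie on
the equator `S^{n-1} = {ψ ∈ S^n : ψ_{n+1} = 0}` and `|u| ≤ 1`. -/
def coordVec {n : ℕ} (ψ : Sph n) (u : ℝ) : EuclideanSpace ℝ (Fin (n + 1)) :=
  Real.sqrt (1 - u ^ 2) • ψ.1 + u • pole n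

/-- The vector obtained from `η = √(1-u²) ψ + u e_{n+1}` by replacing the height `u` by `h u`
while keeping `ψ`. (At the poles the first summand vanishes.) -/
def meridionalVec {n : ℕ} (h : ℝ → ℝ) (η : Sph n) : EuclideanSpace ℝ (Fin (n + 1)) :=
  (Real.sqrt (1 - h (height η) ^ 2) / Real.sqrt (1 - height η ^ 2)) •
    (η.1 - height η • pole n) + h (height η) • pole n

theorem norm_pole (n : ℕ) : ‖pole n‖ = 1 := by simp [pole]

theorem inner_pole {n : ℕ} (x : EuclideanSpace ℝ (Fin (n + 1))) :
    inner ℝ x (pole n) = x (Fin.last n) := by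
  simp [pole, EuclideanSpace.inner_single_right]

theorem norm_sq_sub_height {n : ℕ} (η : Sph n) :
    ‖η.1 - height η • pole n‖ ^ 2 = 1 - height η ^ 2 := by
  have h1 : ‖η.1‖ = 1 := by simp
  rw [norm_sub_sq_real, inner_smul_right, inner_pole, norm_smul, norm_pole, h1]
  simp only [height, Real.norm_eq_abs, mul_one, sq_abs]
  ring

theorem height_mem {n : ℕ} (η : Sph n) : height η ∈ Icc (-1 : ℝ) 1 := by
  have h := norm_sq_sub_height η
  have h2 : height η ^ 2 ≤ 1 := by nlinarith [sq_nonneg ‖η.1 - height η • pole n‖]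
  exact abs_le.mp (by nlinarith [sq_abs (height η), abs_nonneg (height η)])

/-- The admissible changes of height: self-maps of `[-1, 1]` that fix both end points. -/
structure IsHeightMap (h : ℝ → ℝ) : Prop where
  mapsTo : MapsTo h (Icc (-1) 1) (Icc (-1) 1)
  map_one : h 1 = 1
  map_neg_one : h (-1) = -1

theorem eq_one_or_of_sq {u : ℝ} (h : 1 - u ^ 2 = 0) : u = 1 ∨ u = -1 := by
  have h2 : (u - 1) * (u + 1) = 0 := by linarith
  rcases mul_eq_zero.mp h2 with h3 | h3
  · exact Or.inl (by linarith)
  · exact Or.inr (by linarith)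

theorem norm_meridionalVec {n : ℕ} {h : ℝ → ℝ} (hh : IsHeightMap h) (η : Sph n) :
    ‖meridionalVec h η‖ = 1 := by
  have hu := height_mem η
  have hv := hh.mapsTo hu
  have hin : inner ℝ (η.1 - height η • pole n) (pole n) = 0 := by
    rw [inner_sub_left, inner_smul_left, real_inner_self_eq_norm_sq, norm_pole, inner_pole]
    simp [height]
  have key : ‖meridionalVec h η‖ ^ 2 = 1 := by
    rw [meridionalVec, norm_add_sq_real, inner_smul_left, inner_smul_right, hin, norm_smul,
      norm_smul, norm_pole, mul_pow, norm_sq_sub_height, Real.norm_eq_abs, Real.norm_eq_abs,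
      sq_abs, div_pow, Real.sq_sqrt (by nlinarith [hv.1, hv.2]),
      Real.sq_sqrt (by nlinarith [hu.1, hu.2]), mul_one, sq_abs]
    by_cases h0 : 1 - height η ^ 2 = 0
    · rcases eq_one_or_of_sq h0 with h1 | h1
      · rw [h1, hh.map_one]; norm_num
      · rw [h1, hh.map_neg_one]; norm_num
    · field_simp
      simp
  nlinarith [norm_nonneg (meridionalVec h η)]
/-- The meridional map of `S^n` induced by a change of height. -/
def meridional {n : ℕ} (h : ℝ → ℝ) (hh : IsHeightMap h) (η : Sph n) : Sph n :=
  ⟨meridionalVec h η, by simpa using norm_meridionalVec hh η⟩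

theorem height_meridional {n : ℕ} {h : ℝ → ℝ} (hh : IsHeightMap h) (η : Sph n) :
    height (meridional h hh η) = h (height η) := by
  simp [height, meridional, meridionalVec, pole]

/-- A meridional map sends `√(1-u²) ψ + u e_{n+1}` to `√(1-h(u)²) ψ + h(u) e_{n+1}`. -/
theorem meridional_coord {n : ℕ} {h : ℝ → ℝ} (hh : IsHeightMap h) {η ψ : Sph n} {u : ℝ}
    (hψ : height ψ = 0) (hu : u ∈ Icc (-1 : ℝ) 1) (hη : η.1 = coordVec ψ u) :
    (meridional h hh η).1 = coordVec ψ (h u) := by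
  have hhu : height η = u := by
    have hz : ψ.1 (Fin.last n) = 0 := hψ
    simp [height, hη, coordVec, pole, hz]
  simp only [meridional, meridionalVec, hhu, hη, coordVec, add_sub_cancel_right, smul_smul]
  congr 2
  by_cases h0 : Real.sqrt (1 - u ^ 2) = 0
  · have h1 : 1 - u ^ 2 = 0 := (Real.sqrt_eq_zero (by nlinarith [hu.1, hu.2])).mp h0
    rcases eq_one_or_of_sq h1 with rfl | rfl
    · simp [hh.map_one]
    · simp [hh.map_neg_one]
  · field_simp

theorem meridional_meridional {n : ℕ} {g h : ℝ → ℝ} (hg : IsHeightMap g) (hh : IsHeightMap h)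
    (hgh : ∀ u ∈ Icc (-1 : ℝ) 1, g (h u) = u) (η : Sph n) :
    meridional g hg (meridional h hh η) = η := by
  have hu := height_mem η
  apply Subtype.ext
  change meridionalVec g (meridional h hh η) = η.1
  rw [meridionalVec, height_meridional, hgh _ hu]
  simp only [meridional, meridionalVec, add_sub_cancel_right, smul_smul]
  by_cases h0 : 1 - height η ^ 2 = 0
  · have h1 : η.1 - height η • pole n = 0 := by
      have h2 := norm_sq_sub_height η
      rw [h0] at h2
      simpa using h2
    rw [h1, smul_zero, zero_add]
    exact (sub_eq_zero.mp h1).symm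
  · have hv := hh.mapsTo hu
    have h3 : 1 - h (height η) ^ 2 ≠ 0 := by
      intro h4
      apply h0
      have h5 := hgh _ hu
      rcases eq_one_or_of_sq h4 with h6 | h6
      · rw [h6, hg.map_one] at h5; rw [← h5]; norm_num
      · rw [h6, hg.map_neg_one] at h5; rw [← h5]; norm_num
    have h7 : Real.sqrt (1 - height η ^ 2) ≠ 0 := by
      rw [Real.sqrt_ne_zero']
      exact lt_of_le_of_ne (by nlinarith [hu.1, hu.2]) (Ne.symm h0)
    have h8 : Real.sqrt (1 - h (height η) ^ 2) ≠ 0 := by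
      rw [Real.sqrt_ne_zero']
      exact lt_of_le_of_ne (by nlinarith [hv.1, hv.2]) (Ne.symm h3)
    rw [div_mul_div_cancel₀ h8, div_self h7, one_smul, sub_add_cancel]

/-- `u = (v + a) / (1 + a v)`, the height of the point `η` in terms of the height `v` of `μ η`. -/
def muInvHeight (a v : ℝ) : ℝ := (v + a) / (1 + a * v)

/-- `v = (u - a) / (1 - a u)`, the height of `μ η` in terms of the height `u` of `η`. -/
def muHeight (a u : ℝ) : ℝ := (u - a) / (1 - a * u)

/-- `t = s √(1-a²) / √(1-a²s²)`, the height of `ν ξ` in terms of the height `s` of `ξ`. -/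
def nuHeight (a s : ℝ) : ℝ := s * Real.sqrt (1 - a ^ 2) / Real.sqrt (1 - a ^ 2 * s ^ 2)

theorem one_add_mul_pos {a v : ℝ} (ha : a ∈ Ioo (-1 : ℝ) 1) (hv : v ∈ Icc (-1 : ℝ) 1) :
    0 < 1 + a * v := by
  have h1 : |a| < 1 := abs_lt.2 ha
  have h2 : |v| ≤ 1 := abs_le.2 hv
  have h3 : |a * v| < 1 := by
    rw [abs_mul]
    exact lt_of_le_of_lt (mul_le_of_le_one_right (abs_nonneg a) h2) h1
  linarith [(abs_lt.1 h3).1]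

theorem isHeightMap_muInvHeight {a : ℝ} (ha : a ∈ Ioo (-1 : ℝ) 1) :
    IsHeightMap (muInvHeight a) where
  mapsTo := by
    intro v hv
    have hp := one_add_mul_pos ha hv
    obtain ⟨h1, h2⟩ := ha
    obtain ⟨h3, h4⟩ := hv
    refine ⟨?_, ?_⟩
    · rw [muInvHeight, le_div_iff₀ hp]
      nlinarith [mul_nonneg (by linarith : 0 ≤ 1 + a) (by linarith : 0 ≤ 1 + v)]
    · rw [muInvHeight, div_le_one hp]
      nlinarith [mul_nonneg (sub_nonneg.2 h2.le) (sub_nonneg.2 h4)]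
  map_one := by
    have : 1 + a ≠ 0 := by linarith [ha.1]
    rw [muInvHeight, mul_one, div_self this]
  map_neg_one := by
    have : 1 - a ≠ 0 := by linarith [ha.2]
    rw [muInvHeight, div_eq_iff (by linarith [ha.2, ha.1] : 1 + a * (-1) ≠ 0)]
    ring

theorem muHeight_eq (a : ℝ) : muHeight a = muInvHeight (-a) := by
  funext u
  rw [muHeight, muInvHeight, neg_mul, sub_eq_add_neg, sub_eq_add_neg]

theorem isHeightMap_muHeight {a : ℝ} (ha : a ∈ Ioo (-1 : ℝ) 1) : IsHeightMap (muHeight a) := by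
  rw [muHeight_eq]
  exact isHeightMap_muInvHeight ⟨by linarith [ha.2], by linarith [ha.1]⟩

theorem muInvHeight_muHeight {a : ℝ} (ha : a ∈ Ioo (-1 : ℝ) 1) {u : ℝ}
    (hu : u ∈ Icc (-1 : ℝ) 1) : muInvHeight a (muHeight a u) = u := by
  have hp : 0 < 1 - a * u := by
    have := one_add_mul_pos (a := -a) ⟨by linarith [ha.2], by linarith [ha.1]⟩ hu
    linarith
  have hq := one_add_mul_pos ha ((isHeightMap_muHeight ha).mapsTo hu)
  rw [muInvHeight, div_eq_iff hq.ne', muHeight]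
  have hp' : 1 - a * u ≠ 0 := hp.ne'
  have e : (u - a) / (1 - a * u) * (1 - a * u) = u - a := div_mul_cancel₀ _ hp'
  apply mul_right_cancel₀ hp'
  linear_combination (1 - a * u) * e

theorem muHeight_muInvHeight {a : ℝ} (ha : a ∈ Ioo (-1 : ℝ) 1) {v : ℝ}
    (hv : v ∈ Icc (-1 : ℝ) 1) : muHeight a (muInvHeight a v) = v := by
  have ha' : -a ∈ Ioo (-1 : ℝ) 1 := ⟨by linarith [ha.2], by linarith [ha.1]⟩
  have h := muInvHeight_muHeight ha' hv
  rwa [muHeight_eq, neg_neg, ← muHeight_eq] at h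

theorem isHeightMap_nuHeight {a : ℝ} (ha : a ∈ Ioo (-1 : ℝ) 1) : IsHeightMap (nuHeight a) where
  mapsTo := by
    intro s hs
    have h1 : 0 < 1 - a ^ 2 := by nlinarith [ha.1, ha.2]
    have h2 : s ^ 2 ≤ 1 := by nlinarith [hs.1, hs.2]
    have h3 : 0 < 1 - a ^ 2 * s ^ 2 := by nlinarith [sq_nonneg a, sq_nonneg s]
    have h4 : nuHeight a s ^ 2 ≤ 1 := by
      rw [nuHeight, div_pow, mul_pow, Real.sq_sqrt h1.le, Real.sq_sqrt h3.le, div_le_one h3]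
      nlinarith
    exact abs_le.mp (by nlinarith [sq_abs (nuHeight a s), abs_nonneg (nuHeight a s)])
  map_one := by
    have h1 : 0 < 1 - a ^ 2 := by nlinarith [ha.1, ha.2]
    rw [nuHeight, one_pow, mul_one, one_mul, div_self (Real.sqrt_pos.2 h1).ne']
  map_neg_one := by
    have h1 : 0 < 1 - a ^ 2 := by nlinarith [ha.1, ha.2]
    rw [nuHeight, neg_one_sq, mul_one, neg_one_mul, neg_div, div_self (Real.sqrt_pos.2 h1).ne']

/-- The bijection `μ` of `S^n`: it sends `√(1-u²) ψ + u e_{n+1}` to `√(1-v²) ψ + v e_{n+1}`, where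
`u = (v + a) / (1 + a v)`. -/
def mu (n : ℕ) {a : ℝ} (ha : a ∈ Ioo (-1 : ℝ) 1) : Sph n ≃ Sph n where
  toFun := meridional (muHeight a) (isHeightMap_muHeight ha)
  invFun := meridional (muInvHeight a) (isHeightMap_muInvHeight ha)
  left_inv := meridional_meridional _ _ fun _ hu => muInvHeight_muHeight ha hu
  right_inv := meridional_meridional _ _ fun _ hu => muHeight_muInvHeight ha hu

/-- The map `ν` of `S^n`: it sends `√(1-s²) φ + s e_{n+1}` to `√(1-t²) φ + t e_{n+1}`, where
`t = s √(1-a²) / √(1-a²s²)`. -/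
def nu (n : ℕ) {a : ℝ} (ha : a ∈ Ioo (-1 : ℝ) 1) : Sph n → Sph n :=
  meridional (nuHeight a) (isHeightMap_nuHeight ha)

section Operators

variable {𝕜 : Type*} [RCLike 𝕜] {n : ℕ} {a : ℝ}

/-- `(M_a f)(η) = f(μ⁻¹ η) / (1 + a η_{n+1})^{n-1}`. -/
def opM (ha : a ∈ Ioo (-1 : ℝ) 1) (f : Sph n → 𝕜) (η : Sph n) : 𝕜 :=
  ((1 + a * height η) ^ (n - 1))⁻¹ • f ((mu n ha).symm η)

/-- `(N_a Φ)(ξ) = σ_{n-1} (1 - a²)^{(n-1)/2} Φ(ν ξ)`. -/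
def opN (ha : a ∈ Ioo (-1 : ℝ) 1) (Φ : Sph n → 𝕜) (ξ : Sph n) : 𝕜 :=
  (sphereArea (n - 1) * (1 - a ^ 2) ^ (((n : ℝ) - 1) / 2)) • Φ (nu n ha ξ)

end Operators

end

end SphericalSlice

/-!
The map `μ` is the action on `S^n` of a Lorentz boost along the last axis. It is conformal in the
strong sense that `|μ x - μ y| ^ 2 = c x * c y * |x - y| ^ 2` for the factor
`c η = √(1 - a²) / (1 - a η_{n+1})` (`isConformalWith_mu`). A homeomorphism with this property
scales the `d`-dimensional Hausdorff measure with density `c ^ d`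
(`IsConformalWith.map_symm`), which is a change of variables on all of `S^n` and on every
hypersurface without any parametrization.

The preimage under `μ` of the great subsphere orthogonal to `ν ξ` is the slice through
`a e_{n+1}` orthogonal to `ξ` (`mu_preimage_greatSubsphere`), and `c ^ (n - 1)` cancels the weight
in `M_a f` up to the constant `(1 - a²) ^ ((n - 1) / 2)` (`muFactor_pow_smul_opM_mu`). So the two
sides agree, and their integrals converge simultaneously, for every `ξ`.

It remains to see that `M_a f`, which is integrable on `S^n` by the same change of variables, is
integrable on almost every great subsphere (`ae_integrable_greatSubsphere`) and that `ν` pulls null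
sets back to null sets (`surfaceMeasure_nu_preimage_eq_zero`), its inverse being Lipschitz. For the
former, average the area measures of all great subspheres: the resulting finite measure is invariant
under isometries of `S^n`, so its balls have masses depending on the radius only, and Christensen's
argument (`smul_le_smul_of_uniform_balls`) bounds it by a multiple of the surface measure.
-/

namespace SphericalSlice

open scoped NNReal ENNReal Topology ProbabilityTheory

/-! ### Euclidean Hausdorff measure under conformal maps -/

section Conformal

variable {X Y : Type*} [MetricSpace X] [MetricSpace Y]

/-- A homeomorphism is conformal with local scaling factor `c` if distances scale by the geometric
mean of the factors at the two end points. -/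
def IsConformalWith (c : X → ℝ≥0) (T : X ≃ₜ Y) : Prop :=
  ∀ x y, nndist (T x) (T y) ^ 2 = c x * c y * nndist x y ^ 2

theorem IsConformalWith.lipschitzOnWith {c : X → ℝ≥0} {T : X ≃ₜ Y} (hT : IsConformalWith c T)
    {s : Set X} {K : ℝ≥0} (hs : ∀ x ∈ s, c x ≤ K) : LipschitzOnWith K T s := by
  rw [lipschitzOnWith_iff_dist_le_mul]
  intro x hx y hy
  have h : nndist (T x) (T y) ^ 2 ≤ (K * nndist x y) ^ 2 := by
    rw [hT, mul_pow, sq K]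
    gcongr
    exacts [hs x hx, hs y hy]
  exact_mod_cast (pow_le_pow_iff_left₀ zero_le zero_le two_ne_zero).1 h

theorem IsConformalWith.symm {c : X → ℝ≥0} {T : X ≃ₜ Y} (hT : IsConformalWith c T)
    (hc : ∀ x, c x ≠ 0) : IsConformalWith (fun y => (c (T.symm y))⁻¹) T.symm := by
  intro x y
  have h := hT (T.symm x) (T.symm y)
  simp only [Homeomorph.apply_symm_apply] at h
  have h1 := hc (T.symm x)
  have h2 := hc (T.symm y)
  rw [h]
  field_simp

variable [MeasurableSpace X] [BorelSpace X] [MeasurableSpace Y] [BorelSpace Y]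

theorem euclideanHausdorffMeasure_image_le {f : X → Y} {s : Set X} {K : ℝ≥0}
    (h : LipschitzOnWith K f s) (d : ℕ) : μHE[d] (f '' s) ≤ (K : ℝ≥0∞) ^ d * μHE[d] s := by
  simp only [Measure.euclideanHausdorffMeasure_def, Measure.smul_apply, ENNReal.smul_def,
    smul_eq_mul]
  have := h.hausdorffMeasure_image_le (d := d) (Nat.cast_nonneg d)
  rw [ENNReal.rpow_natCast] at this
  grw [this]
  exact (mul_left_comm _ _ _).le

/-- Change of variables: a conformal homeomorphism with factor `c` scales the `d`-dimensional
measure with density `c ^ d`. On the piece where `c` lies in `[q ^ k, q ^ (k + 1))` both the map and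
its inverse are Lipschitz with sharp constants up to a factor `q`, and `q > 1` is arbitrary. -/
theorem IsConformalWith.map_symm {c : X → ℝ≥0} {T : X ≃ₜ Y} (hT : IsConformalWith c T)
    (hc : ∀ x, c x ≠ 0) (hcm : Measurable c) (d : ℕ) :
    Measure.map T.symm (μHE[d] : Measure Y) =
      (μHE[d] : Measure X).withDensity (fun x => ((c x ^ d : ℝ≥0) : ℝ≥0∞)) := by
  set ν := Measure.map T.symm (μHE[d] : Measure Y) with hν
  set ρ := (μHE[d] : Measure X).withDensity (fun x => ((c x ^ d : ℝ≥0) : ℝ≥0∞)) with hρ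
  let f : X → ℝ≥0∞ := fun x => c x
  have hf : Measurable f := hcm.coe_nnreal_ennreal
  have hνs (s : Set X) (hs : MeasurableSet s) : ν s = μHE[d] (T '' s) := by
    rw [hν, Measure.map_apply T.symm.continuous.measurable hs, ← T.image_eq_preimage_symm]
  have h0 (m : Measure X) (s : Set X) : m (s ∩ f ⁻¹' {0}) = 0 := by
    have : f ⁻¹' {0} = ∅ := by ext x; simp [f, hc]
    simp [this]
  have htop (m : Measure X) (s : Set X) : m (s ∩ f ⁻¹' {∞}) = 0 := by
    have : f ⁻¹' {∞} = ∅ := by ext x; simp [f]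
    simp [this]
  -- comparison on one slab, and summation over the slabs
  have key (q : ℝ≥0) (hq : 1 < q) (s : Set X) (hs : MeasurableSet s) :
      ν s ≤ (q : ℝ≥0∞) ^ d * ρ s ∧ ρ s ≤ (q : ℝ≥0∞) ^ d * ν s := by
    have hq0 : q ≠ 0 := (zero_lt_one.trans hq).ne'
    have slab (k : ℤ) : ν (s ∩ f ⁻¹' Ico ((q : ℝ≥0∞) ^ k) ((q : ℝ≥0∞) ^ (k + 1))) ≤
          (q : ℝ≥0∞) ^ d * ρ (s ∩ f ⁻¹' Ico ((q : ℝ≥0∞) ^ k) ((q : ℝ≥0∞) ^ (k + 1))) ∧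
        ρ (s ∩ f ⁻¹' Ico ((q : ℝ≥0∞) ^ k) ((q : ℝ≥0∞) ^ (k + 1))) ≤
          (q : ℝ≥0∞) ^ d * ν (s ∩ f ⁻¹' Ico ((q : ℝ≥0∞) ^ k) ((q : ℝ≥0∞) ^ (k + 1))) := by
      set A := s ∩ f ⁻¹' Ico ((q : ℝ≥0∞) ^ k) ((q : ℝ≥0∞) ^ (k + 1)) with hA
      have hAm : MeasurableSet A := hs.inter (hf measurableSet_Ico)
      have hA1 : ∀ x ∈ A, q ^ k ≤ c x := fun x hx => by
        have := hx.2.1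
        rw [← ENNReal.coe_zpow hq0] at this
        exact ENNReal.coe_le_coe.1 this
      have hA2 : ∀ x ∈ A, c x ≤ q ^ (k + 1) := fun x hx => by
        have := hx.2.2.le
        rw [← ENNReal.coe_zpow hq0] at this
        exact ENNReal.coe_le_coe.1 this
      have hk : (q ^ (k + 1)) = q * q ^ k := by rw [zpow_add₀ hq0, zpow_one, mul_comm]
      have hpos : 0 < q ^ k := zpow_pos (zero_lt_one.trans hq) k
      have lip1 := euclideanHausdorffMeasure_image_le (hT.lipschitzOnWith hA2) d
      have lip2 : μHE[d] A ≤ (((q ^ k)⁻¹ : ℝ≥0) : ℝ≥0∞) ^ d * μHE[d] (T '' A) := by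
        have hl : LipschitzOnWith (q ^ k)⁻¹ T.symm (T '' A) := by
          refine (hT.symm hc).lipschitzOnWith ?_
          rintro _ ⟨x, hx, rfl⟩
          rw [T.symm_apply_apply]
          exact inv_anti₀ hpos (hA1 x hx)
        have := euclideanHausdorffMeasure_image_le hl d
        rwa [image_image, funext (fun x => T.symm_apply_apply x), image_id'] at this
      have hρA : ρ A = ∫⁻ x in A, ((c x ^ d : ℝ≥0) : ℝ≥0∞) ∂μHE[d] := withDensity_apply _ hAm
      have ρlow : (((q ^ k) ^ d : ℝ≥0) : ℝ≥0∞) * μHE[d] A ≤ ρ A := by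
        rw [hρA, ← setLIntegral_const]
        refine setLIntegral_mono' hAm fun x hx => ?_
        gcongr
        exact hA1 x hx
      have ρup : ρ A ≤ (((q * q ^ k) ^ d : ℝ≥0) : ℝ≥0∞) * μHE[d] A := by
        rw [hρA, ← setLIntegral_const]
        refine setLIntegral_mono' hAm fun x hx => ?_
        gcongr
        exact (hA2 x hx).trans hk.le
      rw [hνs A hAm]
      constructor
      · calc μHE[d] (T '' A) ≤ _ := lip1
          _ = (q : ℝ≥0∞) ^ d * ((((q ^ k) ^ d : ℝ≥0) : ℝ≥0∞) * μHE[d] A) := by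
            rw [hk, ← mul_assoc, ← ENNReal.coe_pow, ← ENNReal.coe_pow, ← ENNReal.coe_mul, mul_pow]
          _ ≤ _ := by gcongr
      · calc ρ A ≤ _ := ρup
          _ ≤ (((q * q ^ k) ^ d : ℝ≥0) : ℝ≥0∞) *
              ((((q ^ k)⁻¹ : ℝ≥0) : ℝ≥0∞) ^ d * μHE[d] (T '' A)) := by gcongr
          _ = _ := by
            rw [← mul_assoc, ← ENNReal.coe_pow, ← ENNReal.coe_pow, ← ENNReal.coe_mul, ← mul_pow,
              mul_assoc, mul_inv_cancel₀ hpos.ne', mul_one]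
    rw [measure_eq_measure_preimage_add_measure_tsum_Ico_zpow ν hf hs hq,
      measure_eq_measure_preimage_add_measure_tsum_Ico_zpow ρ hf hs hq]
    simp only [h0, htop, zero_add, ← ENNReal.tsum_mul_left]
    exact ⟨ENNReal.tsum_le_tsum fun k => (slab k).1, ENNReal.tsum_le_tsum fun k => (slab k).2⟩
  have lim (y : ℝ≥0∞) : Filter.Tendsto (fun q : ℝ≥0 => (q : ℝ≥0∞) ^ d * y) (𝓝[>] 1) (𝓝 y) := by
    have h : Filter.Tendsto (fun q : ℝ≥0 => (q : ℝ≥0∞) ^ d * y) (𝓝[>] 1)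
        (𝓝 ((((1 : ℝ≥0) : ℝ≥0∞)) ^ d * y)) :=
      ENNReal.Tendsto.mul (ENNReal.Tendsto.pow (ENNReal.tendsto_coe.2 nhdsWithin_le_nhds))
        (by simp) tendsto_const_nhds (by simp)
    simpa using h
  ext s hs
  refine le_antisymm (ge_of_tendsto (lim _) ?_) (ge_of_tendsto (lim _) ?_)
  · filter_upwards [self_mem_nhdsWithin] with q hq using (key q hq s hs).1
  · filter_upwards [self_mem_nhdsWithin] with q hq using (key q hq s hs).2

end Conformal

/-! ### Measures whose balls have a mass independent of the centre -/

section UniformBalls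

variable {X : Type*} [PseudoMetricSpace X] [SecondCountableTopology X] [MeasurableSpace X]
  [BorelSpace X]

theorem measurable_measure_inter_ball (σ : Measure X) [SFinite σ] {U : Set X}
    (hU : MeasurableSet U) (r : ℝ) : Measurable fun x => σ (U ∩ Metric.ball x r) := by
  have hm : MeasurableSet {p : X × X | p.2 ∈ U ∧ dist p.2 p.1 < r} :=
    (measurable_snd hU).inter
      (measurableSet_lt (measurable_snd.dist measurable_fst) measurable_const)
  exact measurable_measure_prodMk_left hm

/-- Tonelli's theorem for the set of pairs of points of `U` at distance less than `r`. -/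
theorem setLIntegral_measure_inter_ball_comm (m σ : Measure X) [SFinite m] [SFinite σ] (U : Set X)
    (r : ℝ) :
    ∫⁻ x in U, σ (U ∩ Metric.ball x r) ∂m = ∫⁻ y in U, m (U ∩ Metric.ball y r) ∂σ := by
  have hm : MeasurableSet {p : X × X | dist p.2 p.1 < r} :=
    measurableSet_lt (measurable_snd.dist measurable_fst) measurable_const
  have h1 := Measure.prod_apply (μ := m.restrict U) (ν := σ.restrict U) hm
  have h2 := Measure.prod_apply_symm (μ := m.restrict U) (ν := σ.restrict U) hm
  have e1 (x : X) : σ.restrict U (Prod.mk x ⁻¹' {p : X × X | dist p.2 p.1 < r}) =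
      σ (U ∩ Metric.ball x r) := by
    rw [Measure.restrict_apply (measurable_prodMk_left hm), inter_comm]
    rfl
  have e2 (y : X) : m.restrict U ((fun x => (x, y)) ⁻¹' {p : X × X | dist p.2 p.1 < r}) =
      m (U ∩ Metric.ball y r) := by
    rw [Measure.restrict_apply (measurable_prodMk_right hm), inter_comm]
    congr 2
    ext x
    simp [dist_comm]
  simp only [e1] at h1
  simp only [e2] at h2
  rw [← h1, h2]

/-- Two finite measures whose balls have masses depending only on the radius are proportional
(Christensen); this is the inequality from which proportionality follows by symmetry. -/
theorem smul_le_smul_of_uniform_balls (m σ : Measure X) [IsFiniteMeasure m] [IsFiniteMeasure σ]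
    (hm : ∀ r x y, m (Metric.ball x r) = m (Metric.ball y r))
    (hσ : ∀ r x y, σ (Metric.ball x r) = σ (Metric.ball y r)) :
    σ univ • m ≤ m univ • σ := by
  rcases eq_or_ne σ 0 with rfl | hσ0
  · simp
  have : Nonempty X := by
    by_contra h
    rw [not_nonempty_iff] at h
    exact hσ0 (Measure.eq_zero_of_isEmpty σ)
  obtain ⟨o⟩ := this
  have hpos : ∀ r > 0, σ (Metric.ball o r) ≠ 0 := by
    intro r hr h
    apply hσ0
    rw [← Measure.measure_univ_eq_zero]
    refine measure_null_of_locally_null _ fun x _ => ⟨Metric.ball x r, ?_, by rw [hσ r x o, h]⟩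
    exact mem_nhdsWithin_of_mem_nhds (Metric.ball_mem_nhds x hr)
  -- the ratio of the masses of balls does not depend on the radius: Tonelli on the whole space
  have htotal (r : ℝ) : σ (Metric.ball o r) * m univ = m (Metric.ball o r) * σ univ := by
    have := setLIntegral_measure_inter_ball_comm m σ univ r
    simpa only [univ_inter, hσ r _ o, hm r _ o, lintegral_const, Measure.restrict_univ] using this
  have hopen (U : Set X) (hU : IsOpen U) : σ univ * m U ≤ m univ * σ U := by
    let r : ℕ → ℝ := fun k => 1 / ((k : ℝ) + 1)
    have hr (k : ℕ) : 0 < r k := Nat.one_div_pos_of_nat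
    -- `F k` equals `σ univ` at `x` once the ball of radius `r k` about `x` lies in `U`, while its
    -- integral is bounded by Tonelli; Fatou's lemma compares the two
    let F : ℕ → X → ℝ≥0∞ := fun k x =>
      σ univ * (σ (Metric.ball o (r k)))⁻¹ * σ (U ∩ Metric.ball x (r k))
    have hFm (k : ℕ) : Measurable (F k) :=
      (measurable_measure_inter_ball σ hU.measurableSet (r k)).const_mul _
    have hlow : ∀ x ∈ U, σ univ ≤ Filter.liminf (fun k => F k x) Filter.atTop := by
      intro x hx
      refine Filter.le_liminf_of_le (by isBoundedDefault) ?_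
      obtain ⟨ε, hε, hb⟩ := Metric.isOpen_iff.1 hU x hx
      have := tendsto_one_div_add_atTop_nhds_zero_nat (𝕜 := ℝ)
      filter_upwards [this.eventually (gt_mem_nhds hε)] with k hk
      have hsub : U ∩ Metric.ball x (r k) = Metric.ball x (r k) :=
        inter_eq_right.2 ((Metric.ball_subset_ball (le_of_lt hk)).trans hb)
      simp only [F]
      rw [hsub, hσ (r k) x o, mul_assoc,
        ENNReal.inv_mul_cancel (hpos _ (hr k)) (measure_ne_top _ _), mul_one]
    have hup (k : ℕ) : ∫⁻ x in U, F k x ∂m ≤ m univ * σ U := by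
      simp only [F]
      rw [lintegral_const_mul _ (measurable_measure_inter_ball σ hU.measurableSet (r k)),
        setLIntegral_measure_inter_ball_comm m σ U (r k)]
      calc σ univ * (σ (Metric.ball o (r k)))⁻¹ * ∫⁻ y in U, m (U ∩ Metric.ball y (r k)) ∂σ
          ≤ σ univ * (σ (Metric.ball o (r k)))⁻¹ * ∫⁻ _ in U, m (Metric.ball o (r k)) ∂σ := by
            refine mul_le_mul_right (lintegral_mono fun y => ?_) _
            rw [← hm (r k) y o]
            exact measure_mono inter_subset_right
        _ = (σ (Metric.ball o (r k)))⁻¹ * (m (Metric.ball o (r k)) * σ univ) * σ U := by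
            rw [setLIntegral_const]; ring
        _ = m univ * σ U := by
            rw [← htotal, ← mul_assoc,
              ENNReal.inv_mul_cancel (hpos _ (hr k)) (measure_ne_top _ _), one_mul]
    calc σ univ * m U = ∫⁻ _ in U, σ univ ∂m := (setLIntegral_const _ _).symm
      _ ≤ ∫⁻ x in U, Filter.liminf (fun k => F k x) Filter.atTop ∂m :=
        setLIntegral_mono' hU.measurableSet hlow
      _ ≤ Filter.liminf (fun k => ∫⁻ x in U, F k x ∂m) Filter.atTop := lintegral_liminf_le hFm
      _ ≤ m univ * σ U := by
        refine Filter.liminf_le_of_le (by isBoundedDefault) fun b hb => ?_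
        obtain ⟨k, hk⟩ := hb.exists
        exact hk.trans (hup k)
  have : IsFiniteMeasure (m univ • σ) := Measure.smul_finite _ (measure_ne_top _ _)
  refine Measure.le_iff.2 fun s _ => ?_
  rw [s.measure_eq_iInf_isOpen (m univ • σ)]
  refine le_iInf₂ fun U hsU => le_iInf fun hU => ?_
  exact (measure_mono hsU).trans (hopen U hU)

end UniformBalls

/-! ### Finiteness of the surface measures -/

section Finiteness

variable {E : Type*} [NormedAddCommGroup E] [InnerProductSpace ℝ E]

/-- The closed hemisphere opposite to `v` is the stereographic image of a ball of radius `2`. -/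
theorem hemisphere_subset_image_stereoInvFunAux {v : E} (hv : ‖v‖ = 1) :
    {x : E | ‖x‖ = 1 ∧ inner ℝ v x ≤ 0} ⊆
      (fun w : (Submodule.span ℝ {v})ᗮ => stereoInvFunAux v (w : E)) '' Metric.closedBall 0 2 := by
  rintro x ⟨hx, hin⟩
  have hne : x ≠ v := by
    rintro rfl
    rw [real_inner_self_eq_norm_sq, hv] at hin
    norm_num at hin
  let x' : Metric.sphere (0 : E) 1 := ⟨x, by simpa using hx⟩
  refine ⟨stereoToFun v x, ?_, congrArg Subtype.val (stereo_left_inv hv (x := x') hne)⟩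
  rw [mem_closedBall_zero_iff, stereoToFun_apply, norm_smul, innerSL_apply_apply, Real.norm_eq_abs,
    abs_of_pos (by positivity [show 0 < 1 - inner ℝ v x by linarith])]
  have h1 : 2 / (1 - inner ℝ v x) ≤ 2 := by
    rw [div_le_iff₀ (by linarith)]
    linarith
  have h2 : ‖(Submodule.span ℝ {v})ᗮ.orthogonalProjectionOnto x‖ ≤ 1 :=
    ((Submodule.span ℝ {v})ᗮ.norm_orthogonalProjectionOnto_apply_le x).trans hx.le
  nlinarith [norm_nonneg ((Submodule.span ℝ {v})ᗮ.orthogonalProjectionOnto x)]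

theorem euclideanHausdorffMeasure_sphere_lt_top [MeasurableSpace E] [BorelSpace E]
    [FiniteDimensional ℝ E] {d : ℕ} (hd : Module.finrank ℝ E = d + 1) :
    μHE[d] (Metric.sphere (0 : E) 1) < ∞ := by
  have hemi (v : E) (hv : ‖v‖ = 1) : μHE[d] {x : E | ‖x‖ = 1 ∧ inner ℝ v x ≤ 0} < ∞ := by
    have : Fact (Module.finrank ℝ E = d + 1) := ⟨hd⟩
    have hfr : Module.finrank ℝ (Submodule.span ℝ {v})ᗮ = d :=
      Submodule.finrank_orthogonal_span_singleton (by rintro rfl; simp at hv)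
    have hC : ContDiff ℝ 1 (fun w : (Submodule.span ℝ {v})ᗮ => stereoInvFunAux v (w : E)) :=
      contDiff_stereoInvFunAux.comp (Submodule.span ℝ {v})ᗮ.subtypeL.contDiff
    obtain ⟨K, hK⟩ := hC.locallyLipschitz.locallyLipschitzOn.exists_lipschitzOnWith_of_compact
      (isCompact_closedBall (0 : (Submodule.span ℝ {v})ᗮ) 2)
    have hball : μHE[d] (Metric.closedBall (0 : (Submodule.span ℝ {v})ᗮ) 2) < ∞ := by
      have : (μHE[d] : Measure (Submodule.span ℝ {v})ᗮ).IsAddHaarMeasure := hfr ▸ inferInstance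
      exact (isCompact_closedBall _ _).measure_lt_top
    refine (measure_mono (hemisphere_subset_image_stereoInvFunAux hv)).trans_lt ?_
    refine (euclideanHausdorffMeasure_image_le hK d).trans_lt ?_
    exact ENNReal.mul_lt_top (by finiteness) hball
  have : Nontrivial E := Module.nontrivial_of_finrank_pos (R := ℝ) (by omega)
  obtain ⟨v, hv⟩ := exists_norm_eq E zero_le_one
  have hsub : Metric.sphere (0 : E) 1 ⊆
      {x : E | ‖x‖ = 1 ∧ inner ℝ v x ≤ 0} ∪ {x : E | ‖x‖ = 1 ∧ inner ℝ (-v) x ≤ 0} := by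
    intro x hx
    rw [mem_sphere_zero_iff_norm] at hx
    rcases le_total (inner ℝ v x) 0 with h | h
    · exact Or.inl ⟨hx, h⟩
    · exact Or.inr ⟨hx, by rw [inner_neg_left]; linarith⟩
  exact (measure_mono hsub).trans_lt
    (measure_union_lt_top (hemi v hv) (hemi (-v) (by rwa [norm_neg])))

end Finiteness

variable {n : ℕ}

instance : IsFiniteMeasure (surfaceMeasure n) where
  measure_univ_lt_top := by
    rw [surfaceMeasure, ← (isometry_subtype_coe
      (s := Metric.sphere (0 : EuclideanSpace ℝ (Fin (n + 1))) 1)).euclideanHausdorffMeasure_image,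
      image_univ, Subtype.range_coe]
    exact euclideanHausdorffMeasure_sphere_lt_top (by simp)

theorem measurableSet_greatSubsphere (ξ : Sph n) : MeasurableSet (greatSubsphere ξ) :=
  (isClosed_eq (by fun_prop) continuous_const).measurableSet

theorem isFiniteMeasure_sliceMeasure_greatSubsphere (hn : 1 ≤ n) (ξ : Sph n) :
    IsFiniteMeasure (sliceMeasure (greatSubsphere ξ)) where
  measure_univ_lt_top := by
    rw [sliceMeasure, Measure.restrict_apply_univ, ← (isometry_subtype_coe
      (s := Metric.sphere (0 : EuclideanSpace ℝ (Fin (n + 1))) 1)).euclideanHausdorffMeasure_image]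
    let K : Submodule ℝ (EuclideanSpace ℝ (Fin (n + 1))) := (Submodule.span ℝ {ξ.1})ᗮ
    have : Fact (Module.finrank ℝ (EuclideanSpace ℝ (Fin (n + 1))) = n + 1) := ⟨by simp⟩
    have hξ : ξ.1 ≠ 0 := by
      intro h
      have := norm_eq_of_mem_sphere ξ
      simp [h] at this
    have hfr : Module.finrank ℝ K = n - 1 + 1 := by
      rw [Nat.sub_add_cancel hn]
      exact Submodule.finrank_orthogonal_span_singleton hξ
    have hsub : Subtype.val '' greatSubsphere ξ ⊆ K.subtypeₗᵢ '' Metric.sphere (0 : K) 1 := by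
      rintro _ ⟨η, hη, rfl⟩
      refine ⟨⟨η.1, Submodule.mem_orthogonal_singleton_iff_inner_right.2 hη⟩, ?_, rfl⟩
      simp
    refine (measure_mono hsub).trans_lt ?_
    rw [K.subtypeₗᵢ.isometry.euclideanHausdorffMeasure_image]
    exact euclideanHausdorffMeasure_sphere_lt_top hfr

/-! ### Isometries of the sphere and integration over great subspheres -/

/-- The isometry of `S^n` induced by a linear isometry of the ambient space. -/
noncomputable def sphereIsometry
    (g : EuclideanSpace ℝ (Fin (n + 1)) ≃ₗᵢ[ℝ] EuclideanSpace ℝ (Fin (n + 1))) :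
    Sph n ≃ᵢ Sph n where
  toFun x := ⟨g x.1, by simp⟩
  invFun x := ⟨g.symm x.1, by simp⟩
  left_inv x := by simp
  right_inv x := by simp
  isometry_toFun := by
    intro x y
    exact g.isometry.edist_eq x.1 y.1

theorem coe_sphereIsometry
    (g : EuclideanSpace ℝ (Fin (n + 1)) ≃ₗᵢ[ℝ] EuclideanSpace ℝ (Fin (n + 1))) (x : Sph n) :
    (sphereIsometry g x).1 = g x.1 := rfl

/-- The reflection of `S^n` in the bisector of two of its points, which swaps them. It is the
identity if the points agree. -/
noncomputable def swapReflection (x y : Sph n) : Sph n ≃ᵢ Sph n :=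
  sphereIsometry (Submodule.reflection (Submodule.span ℝ {x.1 - y.1})ᗮ)

theorem swapReflection_apply_left (x y : Sph n) : swapReflection x y x = y :=
  Subtype.ext (Submodule.reflection_sub (by simp))

theorem swapReflection_symm_apply_right (x y : Sph n) : (swapReflection x y).symm y = x := by
  rw [IsometryEquiv.symm_apply_eq, swapReflection_apply_left]

theorem measurable_swapReflection (x : Sph n) :
    Measurable fun p : Sph n × Sph n => swapReflection x p.1 p.2 := by
  refine Measurable.subtype_mk ?_
  simp only [Submodule.reflection_orthogonal_apply, Submodule.reflection_singleton_apply,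
    two_smul, RCLike.ofReal_real_eq_id, id]
  fun_prop

theorem sphereIsometry_preimage_greatSubsphere
    (g : EuclideanSpace ℝ (Fin (n + 1)) ≃ₗᵢ[ℝ] EuclideanSpace ℝ (Fin (n + 1))) (ξ : Sph n) :
    sphereIsometry g ⁻¹' greatSubsphere (sphereIsometry g ξ) = greatSubsphere ξ := by
  ext η
  simp [greatSubsphere, coe_sphereIsometry]

theorem map_sphereIsometry_sliceMeasure
    (g : EuclideanSpace ℝ (Fin (n + 1)) ≃ₗᵢ[ℝ] EuclideanSpace ℝ (Fin (n + 1))) (ξ : Sph n) :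
    Measure.map (sphereIsometry g) (sliceMeasure (greatSubsphere ξ)) =
      sliceMeasure (greatSubsphere (sphereIsometry g ξ)) := by
  have h := ((sphereIsometry g).measurePreserving_euclideanHausdorffMeasure
    (n - 1)).restrict_preimage (measurableSet_greatSubsphere (sphereIsometry g ξ))
  rw [sphereIsometry_preimage_greatSubsphere] at h
  exact h.map_eq

theorem measurable_sliceMeasure_greatSubsphere (hn : 1 ≤ n) :
    Measurable fun ξ : Sph n => sliceMeasure (greatSubsphere ξ) := by
  refine Measure.measurable_of_measurable_coe _ fun B hB => ?_
  rcases isEmpty_or_nonempty (Sph n) with h | ⟨⟨o⟩⟩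
  · exact Subsingleton.measurable
  have := isFiniteMeasure_sliceMeasure_greatSubsphere hn o
  have h (ξ : Sph n) : sliceMeasure (greatSubsphere ξ) B = sliceMeasure (greatSubsphere o)
      (Prod.mk ξ ⁻¹' ((fun p : Sph n × Sph n => swapReflection o p.1 p.2) ⁻¹' B)) := by
    conv_lhs => rw [← swapReflection_apply_left o ξ]
    rw [swapReflection, ← map_sphereIsometry_sliceMeasure,
      Measure.map_apply (IsometryEquiv.continuous _).measurable hB]
    rfl
  simp only [h]
  exact measurable_measure_prodMk_left (measurable_swapReflection o hB)

/-- The kernel sending a pole `ξ` to the area measure of the great subsphere `S^n ∩ ξ^⊥`. -/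
noncomputable def greatSubsphereKernel (hn : 1 ≤ n) : ProbabilityTheory.Kernel (Sph n) (Sph n) where
  toFun ξ := sliceMeasure (greatSubsphere ξ)
  measurable' := measurable_sliceMeasure_greatSubsphere hn

theorem greatSubsphereKernel_apply (hn : 1 ≤ n) (ξ : Sph n) :
    greatSubsphereKernel hn ξ = sliceMeasure (greatSubsphere ξ) := rfl

theorem sliceMeasure_greatSubsphere_univ (x y : Sph n) :
    sliceMeasure (greatSubsphere x) univ = sliceMeasure (greatSubsphere y) univ := by
  rw [← swapReflection_apply_left x y, swapReflection, ← map_sphereIsometry_sliceMeasure,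
    Measure.map_apply (IsometryEquiv.continuous _).measurable .univ, preimage_univ]

instance (hn : 1 ≤ n) : ProbabilityTheory.IsFiniteKernel (greatSubsphereKernel hn) := by
  rcases isEmpty_or_nonempty (Sph n) with h | ⟨⟨o⟩⟩
  · exact ⟨0, by simp, fun x => (h.false x).elim⟩
  have := isFiniteMeasure_sliceMeasure_greatSubsphere hn o
  exact ⟨sliceMeasure (greatSubsphere o) univ, measure_lt_top _ _, fun ξ =>
    (sliceMeasure_greatSubsphere_univ ξ o).le⟩

theorem surfaceMeasure_ball (r : ℝ) (x y : Sph n) :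
    surfaceMeasure n (Metric.ball x r) = surfaceMeasure n (Metric.ball y r) := by
  have h := ((swapReflection x y).measurePreserving_euclideanHausdorffMeasure n).measure_preimage
    (measurableSet_ball (x := y) (ε := r)).nullMeasurableSet
  rwa [IsometryEquiv.preimage_ball, swapReflection_symm_apply_right] at h

theorem greatSubsphereKernel_comp_ball (hn : 1 ≤ n) (r : ℝ) (x y : Sph n) :
    (greatSubsphereKernel hn ∘ₘ surfaceMeasure n) (Metric.ball x r) =
      (greatSubsphereKernel hn ∘ₘ surfaceMeasure n) (Metric.ball y r) := by
  rw [Measure.bind_apply measurableSet_ball (ProbabilityTheory.Kernel.aemeasurable _),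
    Measure.bind_apply measurableSet_ball (ProbabilityTheory.Kernel.aemeasurable _)]
  have hmp := (swapReflection x y).measurePreserving_euclideanHausdorffMeasure n
  have h := hmp.lintegral_comp ((greatSubsphereKernel hn).measurable_coe
    (measurableSet_ball (x := y) (ε := r)))
  rw [surfaceMeasure, ← h]
  refine lintegral_congr fun ξ => ?_
  rw [greatSubsphereKernel_apply, greatSubsphereKernel_apply, swapReflection,
    ← map_sphereIsometry_sliceMeasure,
    Measure.map_apply (IsometryEquiv.continuous _).measurable measurableSet_ball]
  congr 1
  change _ = swapReflection x y ⁻¹' _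
  rw [IsometryEquiv.preimage_ball, swapReflection_symm_apply_right]

/-- An integrable function is integrable over almost every great subsphere: averaging the area
measures of all great subspheres gives an isometry invariant measure on `S^n`, hence a multiple of
the surface measure. -/
theorem ae_integrable_greatSubsphere {F : Type*} [NormedAddCommGroup F] (hn : 1 ≤ n)
    {g : Sph n → F} (hg : Integrable g (surfaceMeasure n)) :
    ∀ᵐ ξ ∂surfaceMeasure n, Integrable g (sliceMeasure (greatSubsphere ξ)) := by
  rcases eq_or_ne (surfaceMeasure n) 0 with h0 | h0
  · simp [h0]
  have hu : surfaceMeasure n univ ≠ 0 := by simpa using h0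
  have hle := smul_le_smul_of_uniform_balls (greatSubsphereKernel hn ∘ₘ surfaceMeasure n)
    (surfaceMeasure n) (greatSubsphereKernel_comp_ball hn) surfaceMeasure_ball
  have hint :
      Integrable g (surfaceMeasure n univ • (greatSubsphereKernel hn ∘ₘ surfaceMeasure n)) :=
    (hg.smul_measure (measure_ne_top _ univ)).mono_measure hle
  have hint' : Integrable g (greatSubsphereKernel hn ∘ₘ surfaceMeasure n) :=
    (integrable_smul_measure hu (measure_ne_top _ _)).1 hint
  have := Measure.ae_integrable_of_integrable_comp hint'
  simpa only [greatSubsphereKernel_apply] using this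

/-! ### The map `μ` is conformal -/

variable {a : ℝ}

theorem one_sub_mul_height_pos (ha : a ∈ Ioo (-1 : ℝ) 1) (η : Sph n) : 0 < 1 - a * height η := by
  have := one_add_mul_pos (a := -a) ⟨by linarith [ha.2], by linarith [ha.1]⟩ (height_mem η)
  linarith

theorem one_sub_sq_pos (ha : a ∈ Ioo (-1 : ℝ) 1) : 0 < 1 - a ^ 2 := by nlinarith [ha.1, ha.2]

theorem inner_sub_height_pole (x y : Sph n) :
    inner ℝ (x.1 - height x • pole n) (y.1 - height y • pole n) =
      inner ℝ x.1 y.1 - height x * height y := by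
  have hp : inner ℝ (pole n) (pole n) = 1 := by rw [real_inner_self_eq_norm_sq, norm_pole, one_pow]
  have hx : inner ℝ x.1 (pole n) = height x := inner_pole x.1
  have hy : inner ℝ (pole n) y.1 = height y := by rw [real_inner_comm, inner_pole, height]
  simp only [inner_sub_left, inner_sub_right, real_inner_smul_left, real_inner_smul_right, hp, hx,
    hy]
  ring

theorem inner_sub_height_pole_pole (x : Sph n) :
    inner ℝ (x.1 - height x • pole n) (pole n) = 0 := by
  rw [inner_sub_left, inner_smul_left, inner_pole, real_inner_self_eq_norm_sq, norm_pole]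
  simp [height]

/-- The inner product of two vectors decomposed into horizontal and vertical parts. -/
theorem inner_horizontal_add_vertical (x y : Sph n) (p q r s : ℝ) :
    inner ℝ (p • (x.1 - height x • pole n) + q • pole n)
      (r • (y.1 - height y • pole n) + s • pole n) =
      p * r * (inner ℝ x.1 y.1 - height x * height y) + q * s := by
  have h1 := inner_sub_height_pole_pole x
  have h2 : inner ℝ (pole n) (y.1 - height y • pole n) = 0 := by
    rw [real_inner_comm]; exact inner_sub_height_pole_pole y
  simp only [inner_add_left, inner_add_right, real_inner_smul_left, real_inner_smul_right,
    inner_sub_height_pole, h1, h2]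
  rw [real_inner_self_eq_norm_sq, norm_pole]
  ring

/-- A meridional vector whose horizontal stretching factor is known away from the poles. -/
theorem meridionalVec_eq {h : ℝ → ℝ} {η : Sph n} {p : ℝ} (hp : 0 ≤ p)
    (hph : 1 - h (height η) ^ 2 = p ^ 2 * (1 - height η ^ 2)) :
    meridionalVec h η = p • (η.1 - height η • pole n) + h (height η) • pole n := by
  rw [meridionalVec, hph, Real.sqrt_mul (sq_nonneg p), Real.sqrt_sq hp]
  congr 1
  have hs := norm_sq_sub_height η
  by_cases h0 : √(1 - height η ^ 2) = 0
  · rw [Real.sqrt_eq_zero (by rw [← hs]; positivity)] at h0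
    have : η.1 - height η • pole n = 0 := by simpa [h0] using hs
    simp [this]
  · rw [mul_div_cancel_right₀ _ h0]

theorem meridional_muHeight_coe (ha : a ∈ Ioo (-1 : ℝ) 1) (η : Sph n) :
    (meridional (muHeight a) (isHeightMap_muHeight ha) η).1 =
      (√(1 - a ^ 2) / (1 - a * height η)) • (η.1 - height η • pole n) +
        muHeight a (height η) • pole n := by
  have h1 := one_sub_mul_height_pos ha η
  refine meridionalVec_eq (by positivity) ?_
  rw [muHeight, div_pow, div_pow, Real.sq_sqrt (one_sub_sq_pos ha).le]
  rw [one_sub_div (pow_ne_zero 2 h1.ne'), div_mul_eq_mul_div]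
  congr 1
  ring

theorem continuous_height : Continuous (height : Sph n → ℝ) := by
  unfold height
  fun_prop

theorem continuous_meridional_muHeight (ha : a ∈ Ioo (-1 : ℝ) 1) :
    Continuous (meridional (n := n) (muHeight a) (isHeightMap_muHeight ha)) := by
  refine continuous_induced_rng.2 ?_
  have h : Continuous fun η : Sph n => (√(1 - a ^ 2) / (1 - a * height η)) •
      (η.1 - height η • pole n) + ((height η - a) / (1 - a * height η)) • pole n := by
    have hh : Continuous (height : Sph n → ℝ) := continuous_height
    have h0 (η : Sph n) : 1 - a * height η ≠ 0 := (one_sub_mul_height_pos ha η).ne'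
    fun_prop (disch := assumption)
  exact h.congr fun η => (meridional_muHeight_coe ha η).symm

/-- The map `μ` as a homeomorphism of `S^n`. -/
noncomputable def muHomeomorph (n : ℕ) (ha : a ∈ Ioo (-1 : ℝ) 1) : Sph n ≃ₜ Sph n where
  toEquiv := mu n ha
  continuous_toFun := continuous_meridional_muHeight ha
  continuous_invFun := by
    have h (g : ℝ → ℝ) (hg : IsHeightMap g) (e : g = muHeight (-a)) :
        Continuous (meridional (n := n) g hg) := by
      subst e
      exact continuous_meridional_muHeight ⟨by linarith [ha.2], by linarith [ha.1]⟩
    exact h _ (isHeightMap_muInvHeight ha) (by rw [muHeight_eq, neg_neg])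

theorem muHomeomorph_apply (ha : a ∈ Ioo (-1 : ℝ) 1) (η : Sph n) :
    muHomeomorph n ha η = mu n ha η := rfl

theorem coe_mu (ha : a ∈ Ioo (-1 : ℝ) 1) (η : Sph n) :
    (mu n ha η).1 = (√(1 - a ^ 2) / (1 - a * height η)) • (η.1 - height η • pole n) +
        muHeight a (height η) • pole n := meridional_muHeight_coe ha η

theorem height_mu (ha : a ∈ Ioo (-1 : ℝ) 1) (η : Sph n) :
    height (mu n ha η) = muHeight a (height η) := height_meridional (isHeightMap_muHeight ha) η

/-- The conformal factor `√(1 - a²) / (1 - a η_{n+1})` of `μ`. -/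
noncomputable def muFactor (a : ℝ) (η : Sph n) : ℝ≥0 := (√(1 - a ^ 2) / (1 - a * height η)).toNNReal

theorem coe_muFactor (ha : a ∈ Ioo (-1 : ℝ) 1) (η : Sph n) :
    (muFactor a η : ℝ) = √(1 - a ^ 2) / (1 - a * height η) :=
  Real.coe_toNNReal _ (div_nonneg (Real.sqrt_nonneg _) (one_sub_mul_height_pos ha η).le)

theorem muFactor_ne_zero (ha : a ∈ Ioo (-1 : ℝ) 1) (η : Sph n) : muFactor a η ≠ 0 := by
  rw [← NNReal.coe_ne_zero, coe_muFactor ha]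
  exact (div_pos (Real.sqrt_pos.2 (one_sub_sq_pos ha)) (one_sub_mul_height_pos ha η)).ne'

theorem continuous_muFactor (ha : a ∈ Ioo (-1 : ℝ) 1) :
    Continuous (muFactor a : Sph n → ℝ≥0) := by
  have hh : Continuous (height : Sph n → ℝ) := continuous_height
  have h0 (η : Sph n) : 1 - a * height η ≠ 0 := (one_sub_mul_height_pos ha η).ne'
  exact continuous_real_toNNReal.comp (by fun_prop (disch := assumption))

theorem measurable_muFactor_pow (ha : a ∈ Ioo (-1 : ℝ) 1) (d : ℕ) :
    Measurable fun η : Sph n => muFactor a η ^ d :=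
  (continuous_muFactor ha).measurable.pow_const d

/-- Squared chordal distance in terms of the inner product. -/
theorem dist_sq_eq (x y : Sph n) : dist x y ^ 2 = 2 * (1 - inner ℝ x.1 y.1) := by
  rw [Subtype.dist_eq, dist_eq_norm, norm_sub_sq_real]
  simp only [norm_eq_of_mem_sphere]
  ring

/-- The map `μ` is the boundary action of a Lorentz boost, hence conformal. -/
theorem isConformalWith_mu (ha : a ∈ Ioo (-1 : ℝ) 1) :
    IsConformalWith (muFactor a) (muHomeomorph n ha) := by
  intro x y
  rw [← NNReal.coe_inj]
  push_cast
  have hx := one_sub_mul_height_pos ha x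
  have hy := one_sub_mul_height_pos ha y
  have hs := Real.sq_sqrt (one_sub_sq_pos ha).le
  simp only [coe_muFactor ha, dist_sq_eq, muHomeomorph_apply, coe_mu, inner_horizontal_add_vertical,
    muHeight]
  field_simp
  rw [hs]
  ring

theorem map_muHomeomorph_symm (ha : a ∈ Ioo (-1 : ℝ) 1) (d : ℕ) :
    Measure.map (muHomeomorph n ha).symm μHE[d] =
      (μHE[d]).withDensity fun η => ((muFactor a η ^ d : ℝ≥0) : ℝ≥0∞) :=
  (isConformalWith_mu ha).map_symm (muFactor_ne_zero ha) (continuous_muFactor ha).measurable d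

/-! ### The map `ν` -/

theorem one_sub_sq_mul_height_sq_pos (ha : a ∈ Ioo (-1 : ℝ) 1) (ξ : Sph n) :
    0 < 1 - a ^ 2 * height ξ ^ 2 := by
  have h1 := one_sub_sq_pos ha
  have h2 : height ξ ^ 2 ≤ 1 := by nlinarith [(height_mem ξ).1, (height_mem ξ).2]
  nlinarith [sq_nonneg a, sq_nonneg (height ξ)]

theorem coe_nu (ha : a ∈ Ioo (-1 : ℝ) 1) (ξ : Sph n) :
    (nu n ha ξ).1 = (√(1 - a ^ 2 * height ξ ^ 2))⁻¹ • (ξ.1 - height ξ • pole n) +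
      nuHeight a (height ξ) • pole n := by
  have h3 := one_sub_sq_mul_height_sq_pos ha ξ
  refine meridionalVec_eq (by positivity) ?_
  rw [nuHeight, div_pow, mul_pow, inv_pow, Real.sq_sqrt (one_sub_sq_pos ha).le, Real.sq_sqrt h3.le]
  rw [one_sub_div h3.ne', inv_mul_eq_div]
  congr 1
  ring

/-- The map `μ` carries the slice with normal `ξ` to the great subsphere with normal `ν ξ`. -/
theorem mu_preimage_greatSubsphere (ha : a ∈ Ioo (-1 : ℝ) 1) (ξ : Sph n) :
    mu n ha ⁻¹' greatSubsphere (nu n ha ξ) = slice a ξ := by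
  ext η
  have h1 := one_sub_mul_height_pos ha η
  have h2 := Real.sqrt_pos.2 (one_sub_sq_mul_height_sq_pos ha ξ)
  have h3 := Real.sqrt_pos.2 (one_sub_sq_pos ha)
  have key : inner ℝ (nu n ha ξ).1 (mu n ha η).1 =
      (√(1 - a ^ 2) / (√(1 - a ^ 2 * height ξ ^ 2) * (1 - a * height η))) *
        inner ℝ ξ.1 (η.1 - a • pole n) := by
    rw [coe_nu, coe_mu, inner_horizontal_add_vertical, inner_sub_right, real_inner_smul_right,
      inner_pole, nuHeight, muHeight]
    change _ = _ * (_ - a * height ξ)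
    field_simp
    ring
  simp only [mem_preimage, greatSubsphere, slice, mem_ofPred_eq, key]
  exact mul_eq_zero_iff_left (by positivity)

/-- Radial projection to the unit sphere does not increase distances outside the unit ball. -/
theorem lipschitzOnWith_radial {E : Type*} [NormedAddCommGroup E] [InnerProductSpace ℝ E] :
    LipschitzOnWith 1 (fun x : E => ‖x‖⁻¹ • x) {x | 1 ≤ ‖x‖} := by
  refine LipschitzOnWith.of_dist_le_mul fun x hx y hy => ?_
  rw [mem_ofPred_eq] at hx hy
  rw [NNReal.coe_one, one_mul, dist_eq_norm, dist_eq_norm]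
  refine (pow_le_pow_iff_left₀ (norm_nonneg _) (norm_nonneg _) two_ne_zero).1 ?_
  have hx0 : 0 < ‖x‖ := by linarith
  have hy0 : 0 < ‖y‖ := by linarith
  have hxy : 1 ≤ ‖x‖ * ‖y‖ := by nlinarith
  have hI := real_inner_le_norm x y
  have e : ‖‖x‖⁻¹ • x - ‖y‖⁻¹ • y‖ ^ 2 = 2 * (‖x‖ * ‖y‖ - inner ℝ x y) / (‖x‖ * ‖y‖) := by
    rw [norm_sub_sq_real, norm_smul, norm_smul, real_inner_smul_left, real_inner_smul_right,
      norm_inv, norm_inv, norm_norm, norm_norm]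
    field_simp
    ring
  rw [e, norm_sub_sq_real]
  calc 2 * (‖x‖ * ‖y‖ - inner ℝ x y) / (‖x‖ * ‖y‖) ≤ 2 * (‖x‖ * ‖y‖ - inner ℝ x y) :=
        div_le_self (by linarith) hxy
    _ ≤ _ := by nlinarith [sq_nonneg (‖x‖ - ‖y‖)]

/-- The inverse of `ν` is vertical stretching by `1 / √(1 - a²)` followed by radial projection,
which is Lipschitz; so `ν` pulls null sets back to null sets. -/
theorem surfaceMeasure_nu_preimage_eq_zero (ha : a ∈ Ioo (-1 : ℝ) 1) {N : Set (Sph n)}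
    (hN : surfaceMeasure n N = 0) : surfaceMeasure n (nu n ha ⁻¹' N) = 0 := by
  set b := √(1 - a ^ 2) with hb
  have hb0 : 0 < b := Real.sqrt_pos.2 (one_sub_sq_pos ha)
  have hb1 : b ≤ 1 := Real.sqrt_le_one.2 (by nlinarith [sq_nonneg a])
  let M : EuclideanSpace ℝ (Fin (n + 1)) →L[ℝ] EuclideanSpace ℝ (Fin (n + 1)) :=
    ContinuousLinearMap.id ℝ _ + (b⁻¹ - 1) • (innerSL ℝ (pole n)).smulRight (pole n)
  have hM (x : Sph n) :
      M x.1 = (1 : ℝ) • (x.1 - height x • pole n) + (b⁻¹ * height x) • pole n := by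
    have : M x.1 = x.1 + (b⁻¹ - 1) • (height x • pole n) := by
      simp [M, real_inner_comm, inner_pole, height]
    rw [this]
    module
  have hMnorm : ∀ x ∈ (Subtype.val '' (univ : Set (Sph n))), M x ∈ {x | 1 ≤ ‖x‖} := by
    rintro _ ⟨x, -, rfl⟩
    have h1 : 1 ≤ b⁻¹ := (one_le_inv₀ hb0).2 hb1
    have h2 : ‖M x.1‖ ^ 2 = 1 - height x ^ 2 + (b⁻¹ * height x) ^ 2 := by
      rw [← real_inner_self_eq_norm_sq, hM, inner_horizontal_add_vertical,
        real_inner_self_eq_norm_sq, norm_eq_of_mem_sphere]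
      ring
    rw [mem_ofPred_eq]
    have h3 : height x ^ 2 ≤ (b⁻¹ * height x) ^ 2 := by
      rw [mul_pow]
      exact le_mul_of_one_le_left (sq_nonneg _) (one_le_pow₀ h1)
    exact (one_le_sq_iff₀ (norm_nonneg _)).1 (by linarith)
  have hlip : LipschitzOnWith (1 * ‖M‖₊) ((fun x => ‖x‖⁻¹ • x) ∘ M)
      (Subtype.val '' (univ : Set (Sph n))) :=
    lipschitzOnWith_radial.comp M.lipschitz.lipschitzOnWith hMnorm
  have hinv (ξ : Sph n) : ((fun x => ‖x‖⁻¹ • x) ∘ M) (nu n ha ξ).1 = ξ.1 := by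
    have hk := Real.sqrt_pos.2 (one_sub_sq_mul_height_sq_pos ha ξ)
    have hh : height (nu n ha ξ) = nuHeight a (height ξ) :=
      height_meridional (isHeightMap_nuHeight ha) ξ
    have e : M (nu n ha ξ).1 = (√(1 - a ^ 2 * height ξ ^ 2))⁻¹ • ξ.1 := by
      rw [hM, hh, coe_nu, add_sub_cancel_right, nuHeight, ← hb]
      have : b⁻¹ * (height ξ * b / √(1 - a ^ 2 * height ξ ^ 2)) =
          (√(1 - a ^ 2 * height ξ ^ 2))⁻¹ * height ξ := by field_simp
      rw [this]
      module
    simp only [Function.comp_apply, e, norm_smul, norm_eq_of_mem_sphere, norm_inv,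
      Real.norm_eq_abs, abs_of_pos hk, mul_one, inv_inv, smul_smul, mul_inv_cancel₀ hk.ne',
      one_smul]
  have hiso : Isometry (Subtype.val : Sph n → EuclideanSpace ℝ (Fin (n + 1))) :=
    isometry_subtype_coe
  rw [surfaceMeasure, ← hiso.euclideanHausdorffMeasure_image] at hN ⊢
  have hsub : Subtype.val '' (nu n ha ⁻¹' N) ⊆
      ((fun x => ‖x‖⁻¹ • x) ∘ M) '' (Subtype.val '' N) := by
    rintro _ ⟨ξ, hξ, rfl⟩
    exact ⟨(nu n ha ξ).1, ⟨_, hξ, rfl⟩, hinv ξ⟩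
  have h := euclideanHausdorffMeasure_image_le (hlip.mono (image_mono (subset_univ N))) n
  rw [hN, mul_zero] at h
  exact measure_mono_null hsub (le_antisymm h zero_le)

/-! ### The factorization -/

variable {𝕜 : Type*} [RCLike 𝕜]

theorem opM_mu (ha : a ∈ Ioo (-1 : ℝ) 1) (f : Sph n → 𝕜) (η : Sph n) :
    opM ha f (mu n ha η) = ((1 + a * muHeight a (height η)) ^ (n - 1))⁻¹ • f η := by
  rw [opM, height_mu, Equiv.symm_apply_apply]

theorem opM_mu_comp_symm (ha : a ∈ Ioo (-1 : ℝ) 1) (f : Sph n → 𝕜) :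
    (opM ha f ∘ mu n ha) ∘ (muHomeomorph n ha).symm.toMeasurableEquiv = opM ha f :=
  funext fun η => congrArg (opM ha f) ((mu n ha).apply_symm_apply η)

/-- The Jacobian of `μ` on hypersurfaces cancels the weight of `M_a f` up to a constant. -/
theorem muFactor_pow_smul_opM_mu (ha : a ∈ Ioo (-1 : ℝ) 1) (f : Sph n → 𝕜) (η : Sph n) :
    muFactor a η ^ (n - 1) • opM ha f (mu n ha η) = (√(1 - a ^ 2) ^ (n - 1))⁻¹ • f η := by
  have h1 := one_sub_mul_height_pos ha η
  have h2 := Real.sqrt_pos.2 (one_sub_sq_pos ha)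
  have h3 : (1 + a * muHeight a (height η))⁻¹ * (muFactor a η : ℝ) = (√(1 - a ^ 2))⁻¹ := by
    have h4 : 1 + a * muHeight a (height η) = √(1 - a ^ 2) ^ 2 / (1 - a * height η) := by
      rw [muHeight, Real.sq_sqrt (one_sub_sq_pos ha).le]
      field_simp
      ring
    rw [h4, coe_muFactor ha]
    field_simp
  rw [opM_mu, NNReal.smul_def, smul_smul]
  push_cast
  rw [← inv_pow, ← inv_pow, ← mul_pow, mul_comm, h3]

/-- The pullback by `μ` of the area measure on the great subsphere with normal `ν ξ`. -/
theorem map_muHomeomorph_symm_sliceMeasure (ha : a ∈ Ioo (-1 : ℝ) 1) (ξ : Sph n) :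
    Measure.map (muHomeomorph n ha).symm (sliceMeasure (greatSubsphere (nu n ha ξ))) =
      (sliceMeasure (slice a ξ)).withDensity
        fun η => ((muFactor a η ^ (n - 1) : ℝ≥0) : ℝ≥0∞) := by
  have hm := measurableSet_greatSubsphere (nu n ha ξ)
  have hs : MeasurableSet (slice a ξ) := by
    rw [← mu_preimage_greatSubsphere ha]
    exact (muHomeomorph n ha).measurable hm
  have h := (muHomeomorph n ha).symm.toMeasurableEquiv.restrict_map μHE[n - 1] (slice a ξ)
  rw [sliceMeasure, sliceMeasure, ← restrict_withDensity hs, ← map_muHomeomorph_symm ha]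
  refine Eq.trans ?_ h.symm
  congr 2
  rw [← mu_preimage_greatSubsphere ha]
  ext η
  exact (congrArg (· ∈ greatSubsphere (nu n ha ξ)) ((mu n ha).apply_symm_apply η)).to_iff.symm

theorem integrable_opM_greatSubsphere_iff (ha : a ∈ Ioo (-1 : ℝ) 1) (f : Sph n → 𝕜) (ξ : Sph n) :
    Integrable (opM ha f) (sliceMeasure (greatSubsphere (nu n ha ξ))) ↔
      Integrable f (sliceMeasure (slice a ξ)) := by
  have h2 := Real.sqrt_pos.2 (one_sub_sq_pos ha)
  have h := (muHomeomorph n ha).symm.toMeasurableEquiv.measurableEmbedding.integrable_map_iff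
    (μ := sliceMeasure (greatSubsphere (nu n ha ξ))) (g := opM ha f ∘ mu n ha)
  rw [opM_mu_comp_symm] at h
  rw [← h, Homeomorph.toMeasurableEquiv_coe, map_muHomeomorph_symm_sliceMeasure,
    integrable_withDensity_iff_integrable_smul (measurable_muFactor_pow ha _)]
  simp only [Function.comp_apply, muFactor_pow_smul_opM_mu]
  exact integrable_fun_smul_iff (by positivity) f

theorem integral_opM_greatSubsphere (ha : a ∈ Ioo (-1 : ℝ) 1) (f : Sph n → 𝕜) (ξ : Sph n) :
    ∫ η, opM ha f η ∂sliceMeasure (greatSubsphere (nu n ha ξ)) =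
      (√(1 - a ^ 2) ^ (n - 1))⁻¹ • ∫ η, f η ∂sliceMeasure (slice a ξ) := by
  have h := (muHomeomorph n ha).symm.toMeasurableEquiv.measurableEmbedding.integral_map
    (μ := sliceMeasure (greatSubsphere (nu n ha ξ))) (opM ha f ∘ mu n ha)
  change _ = ∫ η, ((opM ha f ∘ mu n ha) ∘ (muHomeomorph n ha).symm.toMeasurableEquiv) η ∂_ at h
  rw [opM_mu_comp_symm] at h
  rw [← h, Homeomorph.toMeasurableEquiv_coe, map_muHomeomorph_symm_sliceMeasure,
    integral_withDensity_eq_integral_smul (measurable_muFactor_pow ha _)]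
  simp only [Function.comp_apply, muFactor_pow_smul_opM_mu]
  exact integral_smul _ f

theorem integrable_opM (ha : a ∈ Ioo (-1 : ℝ) 1) (hn : 1 ≤ n) {f : Sph n → 𝕜}
    (hf : Integrable f (surfaceMeasure n)) : Integrable (opM ha f) (surfaceMeasure n) := by
  have h := (muHomeomorph n ha).symm.toMeasurableEquiv.measurableEmbedding.integrable_map_iff
    (μ := surfaceMeasure n) (g := opM ha f ∘ mu n ha)
  rw [opM_mu_comp_symm] at h
  rw [← h, Homeomorph.toMeasurableEquiv_coe, surfaceMeasure, map_muHomeomorph_symm,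
    integrable_withDensity_iff_integrable_smul (measurable_muFactor_pow ha _)]
  have hcont : Continuous fun η : Sph n => (muFactor a η : ℝ) * (√(1 - a ^ 2) ^ (n - 1))⁻¹ :=
    (NNReal.continuous_coe.comp (continuous_muFactor ha)).mul continuous_const
  obtain ⟨C, hC⟩ := isCompact_univ.exists_bound_of_continuousOn hcont.continuousOn
  refine (hf.bdd_smul C hcont.aestronglyMeasurable
    (Filter.Eventually.of_forall fun η => hC η (mem_univ η))).congr ?_
  refine Filter.Eventually.of_forall fun η => ?_
  have hpow : muFactor a η ^ n = muFactor a η * muFactor a η ^ (n - 1) := by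
    rw [← pow_succ', Nat.sub_add_cancel hn]
  change ((muFactor a η : ℝ) * (√(1 - a ^ 2) ^ (n - 1))⁻¹) • f η =
    muFactor a η ^ n • opM ha f (mu n ha η)
  rw [hpow, mul_smul, mul_smul, muFactor_pow_smul_opM_mu, NNReal.smul_def]

theorem sphereArea_pos (d : ℕ) : 0 < sphereArea d := by
  unfold sphereArea
  have := Real.Gamma_pos_of_pos (s := ((d : ℝ) + 1) / 2) (by positivity)
  positivity

end SphericalSlice

open SphericalSlice in
theorem theorem3p1 {𝕜 : Type*} [RCLike 𝕜] (n : ℕ) (hn : 2 ≤ n) (a : ℝ)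
    (ha : a ∈ Set.Ioo (-1 : ℝ) 1) (f : Sph n → 𝕜) (hf : Integrable f (surfaceMeasure n)) :
    Integrable (opM ha f) (surfaceMeasure n) ∧
      ∀ᵐ ξ ∂(surfaceMeasure n),
        Integrable f (sliceMeasure (slice a ξ)) ∧
        Integrable (opM ha f) (sliceMeasure (greatSubsphere (nu n ha ξ))) ∧
        sliceTransform a f ξ = opN ha (funk (opM ha f)) ξ := by
  have hn1 : 1 ≤ n := by omega
  have hM := integrable_opM ha hn1 hf
  refine ⟨hM, ?_⟩
  have hae : ∀ᵐ ξ ∂surfaceMeasure n,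
      Integrable (opM ha f) (sliceMeasure (greatSubsphere (nu n ha ξ))) :=
    surfaceMeasure_nu_preimage_eq_zero ha (ae_integrable_greatSubsphere hn1 hM)
  filter_upwards [hae] with ξ hξ
  refine ⟨(integrable_opM_greatSubsphere_iff ha f ξ).1 hξ, hξ, ?_⟩
  have hpos := one_sub_sq_pos ha
  have hpow : (1 - a ^ 2) ^ (((n : ℝ) - 1) / 2) = √(1 - a ^ 2) ^ (n - 1) := by
    rw [Real.sqrt_eq_rpow, ← Real.rpow_mul_natCast hpos.le, Nat.cast_sub hn1]
    congr 1
    push_cast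
    ring
  have hs := (sphereArea_pos (n - 1)).ne'
  have hb : √(1 - a ^ 2) ^ (n - 1) ≠ 0 := (pow_pos (Real.sqrt_pos.2 hpos) _).ne'
  rw [opN, funk, integral_opM_greatSubsphere, hpow, smul_smul, smul_smul, sliceTransform]
  rw [show sphereArea (n - 1) * √(1 - a ^ 2) ^ (n - 1) * (sphereArea (n - 1))⁻¹ *
    (√(1 - a ^ 2) ^ (n - 1))⁻¹ = 1 by field_simp, one_smul]
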